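/- Let $\mathcal H$ be a complex Hilbert space and let $T$ be a bounded linear operator on $\mathcal H$ that is hyponormal, i.e. $TT^*\le T^*T$ (the operator $T^*T-TT^*$ is positive). If $\lambda\in\mathbb C$ is not a limit point of the spectrum $\sigma(T)$ (that is, some neighborhood of $\lambda$ contains no point of $\sigma(T)$ other than possibly $\lambda$ itself), then the range of $T-\lambda I$ is closed in $\mathcal H$. -/

import Mathlib

/-- A bounded operator `T` on a complex Hilbert space is hyponormal if `T T* ≤ T* T`
in the usual (Loewner) order, i.e. if `T* T - T T*` is a positive operator. -/
def IsHyponormal {H : Type*} [NormedAddCommGroup H] [InnerProductSpace ℂ H] [CompleteSpace H]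
    (T : H →L[ℂ] H) : Prop :=
  T * ContinuousLinearMap.adjoint T ≤ ContinuousLinearMap.adjoint T * T

open Filter Topology ContinuousLinearMap
open scoped ENNReal NNReal

/-! A hyponormal operator has norm equal to its spectral radius, and `w - T` and its inverse, when
it exists, are again hyponormal. For `w` near `z` no spectral point is closer to `w` than `z`, so
`‖(w - T)⁻¹‖ ≤ 1/‖w - z‖`: the resolvent has at most a simple pole at `z`. Its residue `P` satisfies
`P (z - T) = 0` and `P + (z - T) G = 1`, so the range of `T - z` is the closed subspace `ker P`. -/

section Resolvent

variable {A : Type*} [NormedRing A] [NormedAlgebra ℂ A] [CompleteSpace A]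

/-- If the resolvent of `a` grows at most like that of a simple pole at `z`, then `z - a` splits off
an element `p` which annihilates it on both sides and such that `1 - p` is a multiple of `z - a`. -/
theorem spectrum.exists_add_mul_eq_one_of_norm_resolvent_le (a : A) (z : ℂ) {C : ℝ}
    (hρ : ∀ᶠ w in 𝓝[≠] z, w ∈ resolventSet ℂ a)
    (hC : ∀ᶠ w in 𝓝[≠] z, ‖(w - z) • resolvent a w‖ ≤ C) :
    ∃ p g : A, (algebraMap ℂ A z - a) * p = 0 ∧ p * (algebraMap ℂ A z - a) = 0 ∧
      p + (algebraMap ℂ A z - a) * g = 1 := by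
  obtain ⟨ε, hε, hball⟩ := Metric.mem_nhdsWithin_iff.mp (hρ.and hC)
  set f : ℂ → A := fun w => (w - z) • resolvent a w with hf
  have hs : Metric.ball z ε ∈ 𝓝 z := Metric.ball_mem_nhds z hε
  have hmem : ∀ w ∈ Metric.ball z ε \ {z}, w ∈ resolventSet ℂ a ∧ ‖f w‖ ≤ C :=
    fun w hw => hball ⟨hw.1, hw.2⟩
  have hd : DifferentiableOn ℂ f (Metric.ball z ε \ {z}) := fun w hw =>
    ((differentiableAt_id.sub_const z).smul
      (spectrum.hasDerivAt_resolvent_const_left (hmem w hw).1).differentiableAt).differentiableWithinAt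
  have hb : BddAbove (norm ∘ f '' (Metric.ball z ε \ {z})) := by
    refine ⟨C, ?_⟩
    rintro _ ⟨w, hw, rfl⟩
    exact (hmem w hw).2
  -- Riemann's removable singularity theorem; the value `F z` is the residue.
  have hF := Complex.differentiableOn_update_limUnder_of_bddAbove hs hd hb
  set F : ℂ → A := Function.update f z (limUnder (𝓝[≠] z) f) with hFdef
  have hFz : DifferentiableAt ℂ F z := hF.differentiableAt hs
  have hev : ∀ᶠ w in 𝓝[≠] z, (algebraMap ℂ A w - a) * F w = algebraMap ℂ A (w - z) ∧
      F w * (algebraMap ℂ A w - a) = algebraMap ℂ A (w - z) := by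
    filter_upwards [hρ, self_mem_nhdsWithin] with w hw hne
    have hu : IsUnit (algebraMap ℂ A w - a) := hw
    have : F w = (w - z) • resolvent a w := Function.update_of_ne hne _ _
    rw [this, resolvent, mul_smul_comm, smul_mul_assoc, Ring.mul_inverse_cancel _ hu,
      Ring.inverse_mul_cancel _ hu, Algebra.algebraMap_eq_smul_one]
    exact ⟨rfl, rfl⟩
  have hcz : Tendsto (fun w => algebraMap ℂ A w - a) (𝓝[≠] z) (𝓝 (algebraMap ℂ A z - a)) :=
    (((algebraMapCLM ℂ A).continuous.tendsto z).sub_const a).mono_left nhdsWithin_le_nhds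
  have hFc : Tendsto F (𝓝[≠] z) (𝓝 (F z)) := hFz.continuousAt.mono_left nhdsWithin_le_nhds
  have h0 : Tendsto (fun w => algebraMap ℂ A (w - z)) (𝓝[≠] z) (𝓝 0) := by
    have : Continuous fun w => algebraMap ℂ A (w - z) :=
      (algebraMapCLM ℂ A).continuous.comp (continuous_id.sub continuous_const)
    simpa using (this.tendsto z).mono_left nhdsWithin_le_nhds
  have hleft : (algebraMap ℂ A z - a) * F z = 0 :=
    tendsto_nhds_unique (hcz.mul hFc) (h0.congr' (hev.mono fun w hw => hw.1.symm))
  have hright : F z * (algebraMap ℂ A z - a) = 0 :=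
    tendsto_nhds_unique (hFc.mul hcz) (h0.congr' (hev.mono fun w hw => hw.2.symm))
  refine ⟨F z, dslope F z z, hleft, hright, ?_⟩
  -- Let `w → z` in `F z + (w - a) * dslope F z w = 1`, which is `(w - a) * F w = w - z` expanded at
  -- `z` and divided by `w - z`.
  have hG : Tendsto (dslope F z) (𝓝[≠] z) (𝓝 (dslope F z z)) :=
    (continuousAt_dslope_same.mpr hFz).mono_left nhdsWithin_le_nhds
  refine tendsto_nhds_unique ((tendsto_const_nhds (x := F z)).add (hcz.mul hG))
    (tendsto_const_nhds.congr' ?_)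
  filter_upwards [hev, self_mem_nhdsWithin] with w hw hne
  have hne' : w - z ≠ 0 := sub_ne_zero.mpr hne
  have hFw : F w = F z + (w - z) • dslope F z w := by rw [sub_smul_dslope]; abel
  have hsplit : algebraMap ℂ A w - a = (w - z) • (1 : A) + (algebraMap ℂ A z - a) := by
    rw [← Algebra.algebraMap_eq_smul_one, map_sub]; abel
  have h1 := hw.1
  rw [hFw, mul_add, mul_smul_comm] at h1
  nth_rewrite 1 [hsplit] at h1
  rw [add_mul, hleft, add_zero, smul_mul_assoc, one_mul, ← smul_add,
    Algebra.algebraMap_eq_smul_one (w - z)] at h1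
  exact (smul_right_injective A hne' h1).symm

end Resolvent

namespace IsHyponormal

variable {H : Type*} [NormedAddCommGroup H] [InnerProductSpace ℂ H] [CompleteSpace H]
  {T : H →L[ℂ] H}

theorem iff_norm_adjoint_apply_le : IsHyponormal T ↔ ∀ x, ‖adjoint T x‖ ≤ ‖T x‖ := by
  have hsa : (adjoint T * T - T * adjoint T).IsSymmetric := by
    rw [← ContinuousLinearMap.isSelfAdjoint_iff_isSymmetric, ← star_eq_adjoint]
    exact (IsSelfAdjoint.star_mul_self T).sub (IsSelfAdjoint.mul_star_self T)
  have hre (x : H) : (adjoint T * T - T * adjoint T).reApplyInnerSelf x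
      = ‖T x‖ ^ 2 - ‖adjoint T x‖ ^ 2 := by
    have h1 : inner ℂ (adjoint T (T x)) x = inner ℂ (T x) (T x) := adjoint_inner_left T x (T x)
    have h2 : inner ℂ (T (adjoint T x)) x = inner ℂ (adjoint T x) (adjoint T x) :=
      (adjoint_inner_right T (adjoint T x) x).symm
    rw [reApplyInnerSelf_apply, sub_apply, ContinuousLinearMap.mul_def, ContinuousLinearMap.mul_def,
      ContinuousLinearMap.comp_apply, ContinuousLinearMap.comp_apply, inner_sub_left, h1, h2, map_sub,
      ← norm_sq_eq_re_inner, ← norm_sq_eq_re_inner]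
  rw [IsHyponormal, ContinuousLinearMap.le_def, isPositive_def]
  refine ⟨fun h x => ?_, fun h => ⟨hsa, fun x => ?_⟩⟩
  · have := h.2 x
    rw [hre, sub_nonneg] at this
    exact le_of_sq_le_sq this (norm_nonneg _)
  · rw [hre, sub_nonneg]
    gcongr
    exact h x

theorem algebraMap_sub (hT : IsHyponormal T) (w : ℂ) :
    IsHyponormal (algebraMap ℂ (H →L[ℂ] H) w - T) := by
  rw [IsHyponormal, ← sub_nonneg] at hT ⊢
  convert hT using 1
  rw [← star_eq_adjoint, ← star_eq_adjoint, star_sub, ← algebraMap_star_comm, mul_sub, mul_sub,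
    sub_mul, sub_mul, sub_mul, sub_mul, Algebra.commutes (star w) T, Algebra.commutes w (star T),
    Algebra.commutes w (algebraMap ℂ (H →L[ℂ] H) (star w))]
  abel

/-- Hyponormality of `T` makes `T* T⁻¹` a contraction; its adjoint `(T⁻¹)* T` is then one too, which
is hyponormality of `T⁻¹`. -/
theorem ringInverse (hT : IsHyponormal T) (hu : IsUnit T) : IsHyponormal (Ring.inverse T) := by
  rw [iff_norm_adjoint_apply_le] at hT ⊢
  set S := Ring.inverse T
  have hTS : T * S = 1 := Ring.mul_inverse_cancel _ hu
  have hK : ‖adjoint T * S‖ ≤ 1 := by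
    refine opNorm_le_bound _ zero_le_one fun x => ?_
    have : T (S x) = x := congr($hTS x)
    simpa [this] using hT (S x)
  have hK' : ‖adjoint S * T‖ ≤ 1 := by
    have : adjoint S * T = star (adjoint T * S) := by
      rw [star_mul, star_eq_adjoint, star_eq_adjoint, adjoint_adjoint]
    rwa [this, norm_star]
  intro x
  have hx : T (S x) = x := congr($hTS x)
  calc ‖adjoint S x‖ = ‖(adjoint S * T) (S x)‖ := by rw [ContinuousLinearMap.mul_def, ContinuousLinearMap.comp_apply, hx]
    _ ≤ 1 * ‖S x‖ := le_of_opNorm_le _ hK' _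
    _ = ‖S x‖ := one_mul _

/-- Cauchy–Schwarz after moving one `T` across the inner product; hyponormality then replaces `T*`
by `T`. By induction this forces `‖T ^ n‖ = ‖T‖ ^ n`. -/
theorem norm_pow_sq_le (hT : IsHyponormal T) (n : ℕ) :
    ‖T ^ (n + 1)‖ ^ 2 ≤ ‖T ^ (n + 2)‖ * ‖T ^ n‖ := by
  have hT' := iff_norm_adjoint_apply_le.mp hT
  refine (Real.le_sqrt (norm_nonneg _) (by positivity)).mp
    (opNorm_le_bound _ (Real.sqrt_nonneg _) fun x => ?_)
  refine le_of_sq_le_sq ?_ (by positivity)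
  rw [mul_pow, Real.sq_sqrt (by positivity)]
  have h1 : (T ^ (n + 1)) x = T ((T ^ n) x) := by rw [pow_succ', ContinuousLinearMap.mul_def, ContinuousLinearMap.comp_apply]
  have h2 : (T ^ (n + 2)) x = T ((T ^ (n + 1)) x) := by rw [pow_succ', ContinuousLinearMap.mul_def, ContinuousLinearMap.comp_apply]
  calc ‖(T ^ (n + 1)) x‖ ^ 2
      = RCLike.re (inner ℂ ((T ^ (n + 1)) x) (T ((T ^ n) x))) := by
        rw [norm_sq_eq_re_inner (𝕜 := ℂ), ← h1]
    _ = RCLike.re (inner ℂ (adjoint T ((T ^ (n + 1)) x)) ((T ^ n) x)) := by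
        rw [adjoint_inner_left]
    _ ≤ ‖adjoint T ((T ^ (n + 1)) x)‖ * ‖(T ^ n) x‖ := re_inner_le_norm _ _
    _ ≤ ‖(T ^ (n + 2)) x‖ * ‖(T ^ n) x‖ := by
        rw [h2]
        gcongr
        exact hT' _
    _ ≤ (‖T ^ (n + 2)‖ * ‖x‖) * (‖T ^ n‖ * ‖x‖) := by
        gcongr <;> exact le_opNorm _ _
    _ = ‖T ^ (n + 2)‖ * ‖T ^ n‖ * ‖x‖ ^ 2 := by ring

theorem norm_pow_succ [Nontrivial H] (hT : IsHyponormal T) (n : ℕ) :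
    ‖T ^ (n + 1)‖ = ‖T‖ ^ (n + 1) := by
  rcases (norm_nonneg T).eq_or_lt with h0 | hpos
  · have : T = 0 := norm_eq_zero.mp h0.symm
    simp [this]
  suffices h : ∀ n : ℕ, ‖T ^ n‖ = ‖T‖ ^ n ∧ ‖T ^ (n + 1)‖ = ‖T‖ ^ (n + 1) from (h n).2
  intro n
  induction n with
  | zero => simp
  | succ n ih =>
    refine ⟨ih.2, le_antisymm (norm_pow_le _ _) ?_⟩
    have h := hT.norm_pow_sq_le n
    rw [ih.1, ih.2] at h
    have : ‖T‖ ^ (n + 1 + 1) * ‖T‖ ^ n ≤ ‖T ^ (n + 2)‖ * ‖T‖ ^ n := by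
      calc _ = (‖T‖ ^ (n + 1)) ^ 2 := by ring
        _ ≤ _ := h
    exact le_of_mul_le_mul_right this (by positivity)

/-- A hyponormal operator is normaloid. -/
theorem spectralRadius_eq_nnnorm [Nontrivial H] (hT : IsHyponormal T) :
    spectralRadius ℂ T = ‖T‖₊ := by
  refine tendsto_nhds_unique (spectrum.pow_nnnorm_pow_one_div_tendsto_nhds_spectralRadius T)
    (tendsto_const_nhds.congr' ?_)
  filter_upwards [eventually_ge_atTop 1] with n hn
  obtain ⟨m, rfl⟩ := Nat.exists_eq_add_of_le' hn
  have : ‖T ^ (m + 1)‖₊ = ‖T‖₊ ^ (m + 1) := NNReal.eq (by simpa using hT.norm_pow_succ m)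
  rw [this, ENNReal.coe_pow, ← ENNReal.rpow_natCast, ← ENNReal.rpow_mul,
    mul_one_div_cancel (by positivity), ENNReal.rpow_one]

theorem norm_le_of_forall_mem_spectrum [Nontrivial H] (hT : IsHyponormal T) {c : ℝ} (hc : 0 ≤ c)
    (h : ∀ k ∈ spectrum ℂ T, ‖k‖ ≤ c) : ‖T‖ ≤ c := by
  lift c to ℝ≥0 using hc
  have : (‖T‖₊ : ℝ≥0∞) ≤ c := by
    rw [← hT.spectralRadius_eq_nnnorm]
    exact iSup₂_le fun k hk => ENNReal.coe_le_coe.mpr (h k hk)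
  exact ENNReal.coe_le_coe.mp this

/-- Nonzero spectral points of the resolvent are `(w - l)⁻¹` with `l` in the spectrum of `T`. -/
theorem norm_resolvent_le [Nontrivial H] (hT : IsHyponormal T) {w : ℂ}
    (hw : w ∈ resolventSet ℂ T) {d : ℝ} (hd : 0 < d) (h : ∀ k ∈ spectrum ℂ T, d ≤ ‖w - k‖) :
    ‖resolvent T w‖ ≤ d⁻¹ := by
  have hu : IsUnit (algebraMap ℂ (H →L[ℂ] H) w - T) := hw
  refine ((hT.algebraMap_sub w).ringInverse hu).norm_le_of_forall_mem_spectrum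
    (inv_nonneg.mpr hd.le) fun k hk => ?_
  rcases eq_or_ne k 0 with rfl | hk0
  · simpa using hd.le
  have hk' : k⁻¹ ∈ spectrum ℂ (algebraMap ℂ (H →L[ℂ] H) w - T) := by
    obtain ⟨u, hu⟩ := hu
    rw [← hu, Ring.inverse_unit] at hk
    rw [← hu]
    simpa using (spectrum.inv_mem_iff (r := Units.mk0 k hk0) (a := u⁻¹)).mp hk
  rw [← spectrum.singleton_sub_eq, Set.singleton_sub] at hk'
  obtain ⟨l, hl, hlk⟩ := hk'
  have hdl : d ≤ ‖k‖⁻¹ := by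
    rw [← norm_inv, ← hlk]
    exact h l hl
  exact (le_inv_comm₀ hd (norm_pos_iff.mpr hk0)).mp hdl

end IsHyponormal

theorem corollary3p3 {H : Type*} [NormedAddCommGroup H] [InnerProductSpace ℂ H]
    [CompleteSpace H] (T : H →L[ℂ] H) (hT : IsHyponormal T) (z : ℂ)
    (hz : ¬ AccPt z (Filter.principal (spectrum ℂ T))) :
    IsClosed (Set.range (fun x : H => (T - z • (1 : H →L[ℂ] H)) x)) := by
  rcases subsingleton_or_nontrivial H with hH | hH
  · exact Set.Subsingleton.isClosed (Set.subsingleton_of_subsingleton)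
  have hρ : ∀ᶠ w in 𝓝[≠] z, w ∈ resolventSet ℂ T := by
    rw [accPt_iff_frequently_nhdsNE, not_frequently] at hz
    exact hz.mono fun w hw => not_not.mp hw
  obtain ⟨ε, hε, hball⟩ := Metric.mem_nhdsWithin_iff.mp hρ
  have hC : ∀ᶠ w in 𝓝[≠] z, ‖(w - z) • resolvent T w‖ ≤ 1 := by
    -- Radius `ε / 2`: a `k` closer to `w` than `z` is would lie within `ε` of `z`, where only `z`
    -- can be spectral.
    filter_upwards [hρ, self_mem_nhdsWithin,
      nhdsWithin_le_nhds (Metric.ball_mem_nhds z (half_pos hε))] with w hw hne hwε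
    have hpos : 0 < ‖w - z‖ := norm_pos_iff.mpr (sub_ne_zero.mpr hne)
    have hres : ‖resolvent T w‖ ≤ ‖w - z‖⁻¹ := by
      refine hT.norm_resolvent_le hw hpos fun k hk => ?_
      by_contra! hlt
      rw [Metric.mem_ball, dist_eq_norm] at hwε
      have hkz : k ≠ z := by
        rintro rfl
        exact lt_irrefl _ hlt
      refine hk (hball ⟨?_, hkz⟩)
      rw [Metric.mem_ball, dist_eq_norm]
      calc ‖k - z‖ = ‖(w - z) - (w - k)‖ := by congr 1; abel
        _ ≤ ‖w - z‖ + ‖w - k‖ := norm_sub_le _ _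
        _ < ε := by linarith
    calc ‖(w - z) • resolvent T w‖ = ‖w - z‖ * ‖resolvent T w‖ := norm_smul _ _
      _ ≤ ‖w - z‖ * ‖w - z‖⁻¹ := by gcongr
      _ = 1 := mul_inv_cancel₀ hpos.ne'
  obtain ⟨P, G, -, hP, hPG⟩ := spectrum.exists_add_mul_eq_one_of_norm_resolvent_le T z hρ hC
  rw [Algebra.algebraMap_eq_smul_one, ← neg_sub] at hP hPG
  have hrange : Set.range (fun x : H => (T - z • (1 : H →L[ℂ] H)) x) = {x | P x = 0} := by
    ext y
    constructor
    · rintro ⟨x, rfl⟩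
      rw [mul_neg, neg_eq_zero] at hP
      exact congr($hP x)
    · intro hy
      refine ⟨-G y, ?_⟩
      have h := congr($hPG y)
      rw [add_apply, hy, zero_add, neg_mul, neg_apply,
        ContinuousLinearMap.mul_def, ContinuousLinearMap.comp_apply] at h
      simpa only [map_neg, one_apply_eq_self] using h
  rw [hrange]
  exact isClosed_eq P.continuous continuous_const
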